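/- Let $X, Y$ be Souslin locally convex spaces (real locally convex spaces that are images of Polish spaces under continuous mappings), let $\eta_1$ and $\eta_2$ be Borel probability measures on $X$ and $Y$, and let $\eta = \eta_1 \otimes \eta_2$. A vector $e \in X$ is called a vector of continuity of $\eta_1$ if $\lim_{t \to 0} \|(\eta_1)_{te} - \eta_1\| = 0$, where $(\eta_1)_{te}(A) = \eta_1(A + te)$ for Borel sets $A \subset X$ and $\|\cdot\|$ is the total variation norm; let $X_C$ be the set of vectors of continuity of $\eta_1$, and let $Y_C \subset Y$ be the set of vectors of continuity of $\eta_2$, defined in the same way. Let $h \colon X \times Y \to \mathbb R$ be a Borel measurable function. Suppose that for $\eta$-a.e. point $(x_0, y_0) \in X \times Y$ there exist an open neighbourhood $W$ of $(x_0, y_0)$ and vectors $e_1 \in X_C$, $e_2 \in Y_C$ such that for all $(x, y) \in W$ the second order partial derivative $\frac{\partial^2 h}{\partial e_1 \partial e_2}(x, y) = \frac{\partial}{\partial e_1}\bigl(\frac{\partial h}{\partial e_2}\bigr)(x, y)$ exists and is nonzero. Then $h$ satisfies the non-degeneracy condition with respect to $\eta$: there do not exist a Borel set $A \subset X \times Y$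 with $\eta(A) > 0$ and functions $u \colon X \to \mathbb R$, $v \colon Y \to \mathbb R$ such that $h(x, y) = u(x) + v(y)$ for all $(x, y) \in A$. -/

import Mathlib

open Set Filter Topology MeasureTheory

/-- A Souslin space: the image of a Polish space under a continuous mapping. (A Polish space has at
most the cardinality of the continuum, so that Polish spaces in `Type` are enough.) Separation of
`X` is not required, which only makes the class larger. -/
class SouslinSpace (X : Type*) [TopologicalSpace X] : Prop where
  exists_polish : ∃ (P : Type) (_ : TopologicalSpace P) (_ : PolishSpace P) (f : P → X),
    Continuous f ∧ Function.Surjective f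

/-- On a product of two Souslin spaces the product of the Borel σ-algebras is the Borel σ-algebra
of the product topology, so that "measurable" in `X × Y` means "Borel measurable" and a product of
Borel measures is a Borel measure. -/
theorem SouslinSpace.borelSpace_prod (X Y : Type*) [TopologicalSpace X] [TopologicalSpace Y]
    [MeasurableSpace X] [BorelSpace X] [MeasurableSpace Y] [BorelSpace Y]
    [hX : SouslinSpace X] [hY : SouslinSpace Y] : BorelSpace (X × Y) := by
  obtain ⟨P, _, _, f, hf, hfs⟩ := hX.exists_polish
  obtain ⟨Q, _, _, g, hg, hgs⟩ := hY.exists_polish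
  refine ⟨le_antisymm prod_le_borel_prod ?_⟩
  refine MeasurableSpace.generateFrom_le fun s hs => ?_
  -- the open rectangles contained in the open set `s`
  let ι := {r : Set X × Set Y // IsOpen r.1 ∧ IsOpen r.2 ∧ r.1 ×ˢ r.2 ⊆ s}
  obtain ⟨t, htc, ht⟩ := eq_open_union_countable
    (fun i : ι => (Prod.map f g) ⁻¹' (i.1.1 ×ˢ i.1.2))
    (fun i => (i.2.1.prod i.2.2.1).preimage (hf.prodMap hg))
  have hs' : s = ⋃ i ∈ t, i.1.1 ×ˢ i.1.2 := by
    apply Subset.antisymm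
    · rintro ⟨x, y⟩ hxy
      obtain ⟨u, v, hu, hv, hxu, hyv, huv⟩ := isOpen_prod_iff.1 hs x y hxy
      obtain ⟨p, rfl⟩ := hfs x
      obtain ⟨q, rfl⟩ := hgs y
      have hmem : (p, q) ∈ ⋃ i : ι, (Prod.map f g) ⁻¹' (i.1.1 ×ˢ i.1.2) :=
        mem_iUnion.2 ⟨⟨(u, v), hu, hv, huv⟩, hxu, hyv⟩
      rw [← ht] at hmem
      simpa only [mem_iUnion, mem_preimage, Prod.map_apply] using hmem
    · exact iUnion₂_subset fun i _ => i.2.2.2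
  rw [hs']
  exact MeasurableSet.biUnion htc fun i _ =>
    i.2.1.measurableSet.prod i.2.2.1.measurableSet

/-- The shift `μ_e` of a measure, `μ_e (A) = μ (A + e)`: the image of `μ` under `x ↦ x - e`. -/
noncomputable def shiftMeasure {X : Type*} [AddCommGroup X] [MeasurableSpace X]
    (μ : Measure X) (e : X) : Measure X :=
  μ.map (fun x => x - e)

instance shiftMeasure.instIsFiniteMeasure {X : Type*} [AddCommGroup X] [MeasurableSpace X]
    (μ : Measure X) [IsFiniteMeasure μ] (e : X) : IsFiniteMeasure (shiftMeasure μ e) := by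
  unfold shiftMeasure
  infer_instance

/-- The set of the vectors of continuity of a finite measure `μ`: the vectors `e` along which `μ`
is continuous, that is, `‖μ_{te} - μ‖ → 0` as `t → 0` in the total variation norm. -/
def continuityVectors {X : Type*} [AddCommGroup X] [Module ℝ X] [MeasurableSpace X]
    (μ : Measure X) [IsFiniteMeasure μ] : Set X :=
  {e | Tendsto (fun t : ℝ =>
      ((shiftMeasure μ (t • e)).toSignedMeasure - μ.toSignedMeasure).totalVariation univ)
    (𝓝 0) (𝓝 0)}

/-- The second order partial derivative `∂²h/∂e₁∂e₂ = ∂/∂e₁ (∂h/∂e₂)` exists at the point `p` of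
`X × Y` and equals `c`: the partial derivative `∂h/∂e₂` exists at the points `p + s e₁` for all
small `s`, and it has at `p` the partial derivative `c` along `e₁`. Here `e₁` and `e₂` are regarded
as the vectors `(e₁, 0)` and `(0, e₂)` of `X × Y`. -/
def HasMixedPartialDerivAt {X Y : Type*} [AddCommGroup X] [Module ℝ X] [AddCommGroup Y] [Module ℝ Y]
    (h : X × Y → ℝ) (c : ℝ) (p : X × Y) (e₁ : X) (e₂ : Y) : Prop :=
  (∀ᶠ s : ℝ in 𝓝 0, LineDifferentiableAt ℝ h (p + s • ((e₁, 0) : X × Y)) (0, e₂)) ∧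
    HasLineDerivAt ℝ (fun q => lineDeriv ℝ h q (0, e₂)) c p (e₁, 0)

/-- The non-degeneracy condition for a cost function `h` with respect to a measure `η`: there are no
measurable set `A` with `η A > 0` and (arbitrary) functions `u`, `v` such that
`h (x, y) = u x + v y` for all `(x, y) ∈ A`. -/
def SatisfiesNondegeneracy {X Y : Type*} [MeasurableSpace X] [MeasurableSpace Y]
    (h : X × Y → ℝ) (η : Measure (X × Y)) : Prop :=
  ¬ ∃ A : Set (X × Y), MeasurableSet A ∧ 0 < η A ∧
    ∃ (u : X → ℝ) (v : Y → ℝ), ∀ x y, (x, y) ∈ A → h (x, y) = u x + v y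

/-! Suppose h = u + v on a set A of positive measure. By the Lindelöf property, some open W with
fixed directions e₁, e₂ meets A in positive measure. Continuity of η along e₂ gives one sequence tₙ
→ 0 with z + tₙe₂ ∈ A eventually, for a.e. z ∈ A (`exists_seq_ae_eventually_add_mem`). Along it the
u terms cancel, so ∂h/∂e₂ is a limit of difference quotients of v alone and depends only on y on a
set A' of full measure in A ∩ W. The same recurrence for A' along e₁ makes the mixed derivative
vanish at some point of W, a contradiction. No regularity of u or v is used. -/

open scoped ENNReal

/-- A measure is continuous along `w` if its shifts by `t • w` exceed it by arbitrarily little,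
uniformly over all measurable sets, as `t → 0`. -/
def ContinuousAlong {Z : Type*} [AddCommGroup Z] [Module ℝ Z] [MeasurableSpace Z]
    (ν : Measure Z) (w : Z) : Prop :=
  ∀ ε : ℝ≥0∞, 0 < ε → ∀ᶠ t : ℝ in 𝓝 0, ∀ B : Set Z, MeasurableSet B →
    ν ((fun z => z - t • w) ⁻¹' B) ≤ ν B + ε

theorem continuousAlong_of_mem_continuityVectors {X : Type*} [AddCommGroup X] [Module ℝ X]
    [TopologicalSpace X] [IsTopologicalAddGroup X] [MeasurableSpace X] [BorelSpace X]
    {μ : Measure X} [IsFiniteMeasure μ] {e : X} (he : e ∈ continuityVectors μ) :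
    ContinuousAlong μ e := by
  intro ε hε
  filter_upwards [ENNReal.tendsto_nhds_zero.1 he ε hε] with t ht B hB
  set s := (shiftMeasure μ (t • e)).toSignedMeasure - μ.toSignedMeasure with hs
  have hle : ‖s B‖ₑ ≤ ε :=
    (s.enorm_le_totalVariation B).trans ((measure_mono (subset_univ B)).trans ht)
  have hsB : s B = (shiftMeasure μ (t • e)).real B - μ.real B := by
    rw [hs, _root_.sub_apply, Measure.toSignedMeasure_apply_measurable hB,
      Measure.toSignedMeasure_apply_measurable hB]
  have hmap : shiftMeasure μ (t • e) B = μ ((fun z => z - t • e) ⁻¹' B) :=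
    Measure.map_apply (continuous_sub_right _).measurable hB
  rw [← hmap, ← ofReal_measureReal (measure_ne_top _ B), ← ofReal_measureReal (measure_ne_top μ B)]
  calc ENNReal.ofReal ((shiftMeasure μ (t • e)).real B)
      ≤ ENNReal.ofReal (μ.real B + ‖s B‖) := by
        apply ENNReal.ofReal_le_ofReal
        have := le_abs_self (s B)
        rw [Real.norm_eq_abs]
        linarith
    _ = ENNReal.ofReal (μ.real B) + ‖s B‖ₑ := by
        rw [ENNReal.ofReal_add measureReal_nonneg (norm_nonneg _), ofReal_norm]
    _ ≤ _ := by gcongr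

namespace ContinuousAlong

section Prod

variable {X Y : Type*} [AddCommGroup X] [Module ℝ X] [MeasurableSpace X]
  [AddCommGroup Y] [Module ℝ Y] [MeasurableSpace Y]

theorem prod_left {μ : Measure X} {ν : Measure Y} [IsFiniteMeasure μ] [IsProbabilityMeasure ν]
    {e : X} (he : ContinuousAlong μ e) (hm : ∀ t : ℝ, Measurable fun x : X => x - t • e) :
    ContinuousAlong (μ.prod ν) ((e, 0) : X × Y) := by
  intro ε hε
  filter_upwards [he ε hε] with t ht B hB
  have hmeas : Measurable fun z : X × Y => z - t • ((e, 0) : X × Y) := by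
    have : (fun z : X × Y => z - t • ((e, 0) : X × Y)) = Prod.map (fun x => x - t • e) id := by
      ext z <;> simp
    rw [this]
    exact (hm t).prodMap measurable_id
  rw [Measure.prod_apply_symm (hmeas hB), Measure.prod_apply_symm hB]
  calc _ ≤ ∫⁻ y, (μ ((fun x => (x, y)) ⁻¹' B) + ε) ∂ν := by
        refine lintegral_mono fun y => ?_
        have := ht ((fun x => (x, y)) ⁻¹' B) (measurable_prodMk_right hB)
        simpa [preimage_preimage] using this
    _ = _ := by
        rw [lintegral_add_right _ measurable_const]
        simp

theorem prod_right {μ : Measure X} {ν : Measure Y} [IsProbabilityMeasure μ] [IsFiniteMeasure ν]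
    {e : Y} (he : ContinuousAlong ν e) (hm : ∀ t : ℝ, Measurable fun y : Y => y - t • e) :
    ContinuousAlong (μ.prod ν) ((0, e) : X × Y) := by
  intro ε hε
  filter_upwards [he ε hε] with t ht B hB
  have hmeas : Measurable fun z : X × Y => z - t • ((0, e) : X × Y) := by
    have : (fun z : X × Y => z - t • ((0, e) : X × Y)) = Prod.map id (fun y => y - t • e) := by
      ext z <;> simp
    rw [this]
    exact measurable_id.prodMap (hm t)
  rw [Measure.prod_apply (hmeas hB), Measure.prod_apply hB]
  calc _ ≤ ∫⁻ x, (ν (Prod.mk x ⁻¹' B) + ε) ∂μ := by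
        refine lintegral_mono fun x => ?_
        have := ht (Prod.mk x ⁻¹' B) (measurable_prodMk_left hB)
        simpa [preimage_preimage] using this
    _ = _ := by
        rw [lintegral_add_right _ measurable_const]
        simp

end Prod

/-! ### Recurrence of Borel sets under small shifts. -/

variable {Z : Type*} [AddCommGroup Z] [Module ℝ Z] [TopologicalSpace Z] [IsTopologicalAddGroup Z]
  [ContinuousSMul ℝ Z] [MeasurableSpace Z] [BorelSpace Z] {ν : Measure Z} [IsFiniteMeasure ν]
  {w : Z}

set_option linter.unusedSectionVars false in
theorem measurableSet_preimage {B : Set Z} (hB : MeasurableSet B) (t : ℝ) :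
    MeasurableSet ((fun z => z - t • w) ⁻¹' B) :=
  (continuous_sub_right _).measurable hB

/-- For C the shifted set, ν(C \ B) = ν(C) - ν(B) + ν(B \ C), so the one-sided bound on ν(C)
suffices. This is the complement step of the induction below. -/
theorem tendsto_measure_preimage_diff (hw : ContinuousAlong ν w) {B : Set Z}
    (hB : MeasurableSet B)
    (h : Tendsto (fun t : ℝ => ν (B \ (fun z => z - t • w) ⁻¹' B)) (𝓝 0) (𝓝 0)) :
    Tendsto (fun t : ℝ => ν ((fun z => z - t • w) ⁻¹' B \ B)) (𝓝 0) (𝓝 0) := by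
  rw [ENNReal.tendsto_nhds_zero] at h ⊢
  intro ε hε
  have hε2 : 0 < ε / 2 := ENNReal.half_pos hε.ne'
  filter_upwards [h _ hε2, hw _ hε2] with t h1 h2
  set C := (fun z => z - t • w) ⁻¹' B
  have hC : MeasurableSet C := measurableSet_preimage hB t
  have hCB : ν (C ∩ B) + ν (C \ B) = ν C := measure_inter_add_sdiff C hB
  have hBC : ν (B ∩ C) + ν (B \ C) = ν B := measure_inter_add_sdiff B hC
  rw [inter_comm] at hBC
  have key : ν (C ∩ B) + ν (C \ B) ≤ ν (C ∩ B) + ε :=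
    calc _ = ν C := hCB
      _ ≤ ν B + ε / 2 := h2 B hB
      _ = ν (C ∩ B) + (ν (B \ C) + ε / 2) := by rw [← hBC, add_assoc]
      _ ≤ ν (C ∩ B) + (ε / 2 + ε / 2) := by gcongr
      _ = _ := by rw [ENNReal.add_halves]
  exact (ENNReal.add_le_add_iff_left (measure_ne_top _ _)).1 key

/-- π-λ induction from open sets, where a small shift of a point of G stays in G and dominated
convergence applies. -/
theorem tendsto_measure_diff_preimage (hw : ContinuousAlong ν w) {B : Set Z}
    (hB : MeasurableSet B) :
    Tendsto (fun t : ℝ => ν (B \ (fun z => z - t • w) ⁻¹' B)) (𝓝 0) (𝓝 0) := by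
  induction B, hB using MeasurableSpace.induction_on_inter (BorelSpace.measurable_eq (α := Z))
    isPiSystem_isOpen with
  | empty => simp
  | basic G hG =>
    have hG : IsOpen G := hG
    rw [← measure_empty (μ := ν)]
    refine tendsto_measure_of_ae_tendsto_indicator_of_isFiniteMeasure _ MeasurableSet.empty
      (fun t => hG.measurableSet.diff (measurableSet_preimage hG.measurableSet t))
      (ae_of_all _ fun z => ?_)
    by_cases hz : z ∈ G
    · have hc : Tendsto (fun t : ℝ => z - t • w) (𝓝 0) (𝓝 z) := by
        have : Continuous fun t : ℝ => z - t • w := by fun_prop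
        simpa using this.tendsto 0
      filter_upwards [hc (hG.mem_nhds hz)] with t ht
      have ht : z - t • w ∈ G := ht
      simp [ht]
    · simp [hz]
  | compl B hB ih =>
    refine (hw.tendsto_measure_preimage_diff hB ih).congr fun t => ?_
    congr 1
    ext z
    simp [and_comm]
  | iUnion f hd hf ih =>
    have hsum : Tendsto (fun t : ℝ => ∑' n, ν (f n \ (fun z => z - t • w) ⁻¹' f n)) (𝓝 0)
        (𝓝 0) := by
      -- The series is an integral over counting measure, dominated by the terms ν(f n), summable by
      -- disjointness.
      have := tendsto_lintegral_filter_of_dominated_convergence (μ := Measure.count) (l := 𝓝 (0 : ℝ))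
        (F := fun t n => ν (f n \ (fun z => z - t • w) ⁻¹' f n)) (f := fun _ => 0)
        (fun n => ν (f n)) (Eventually.of_forall fun _ => measurable_of_countable _)
        (Eventually.of_forall fun _ => ae_of_all _ fun _ => measure_mono sdiff_subset)
        (by
          rw [lintegral_count, ← measure_iUnion hd hf]
          exact measure_ne_top _ _)
        (ae_of_all _ ih)
      simpa [lintegral_count] using this
    refine tendsto_of_tendsto_of_tendsto_of_le_of_le tendsto_const_nhds hsum (fun _ => zero_le)
      fun t => ?_
    refine (measure_mono ?_).trans (measure_iUnion_le _)
    rintro z ⟨hz, hz'⟩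
    obtain ⟨n, hn⟩ := mem_iUnion.1 hz
    refine mem_iUnion.2 ⟨n, hn, fun h => hz' ?_⟩
    exact mem_iUnion.2 ⟨n, h⟩

/-- Borel–Cantelli: shifts are chosen so small that the measures of the exceptional sets are
summable. The sequence does not depend on z. -/
theorem exists_seq_ae_eventually_add_mem (hw : ContinuousAlong ν w) {B : Set Z}
    (hB : MeasurableSet B) :
    ∃ t : ℕ → ℝ, Tendsto t atTop (𝓝[≠] 0) ∧
      ∀ᵐ z ∂ν, z ∈ B → ∀ᶠ n in atTop, z + t n • w ∈ B := by
  have hlim := (hw.tendsto_measure_diff_preimage hB).mono_left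
    (nhdsWithin_le_nhds (s := ({0}ᶜ : Set ℝ)))
  obtain ⟨r, hr⟩ := exists_seq_tendsto (𝓝[≠] (0 : ℝ))
  obtain ⟨δ, hδ, hδs⟩ := ENNReal.exists_pos_sum_of_countable' one_ne_zero ℕ
  choose k hk using fun n => ((((ENNReal.tendsto_nhds_zero.1 (hlim.comp hr) (δ n) (hδ n)).and
    (eventually_ge_atTop n))).exists)
  have hk' : Tendsto k atTop atTop := tendsto_atTop_mono (fun n => (hk n).2) tendsto_id
  have hneg : Tendsto (fun x : ℝ => -x) (𝓝[≠] 0) (𝓝[≠] 0) := by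
    refine tendsto_nhdsWithin_iff.2 ⟨?_, ?_⟩
    · have : Tendsto (fun x : ℝ => -x) (𝓝 0) (𝓝 0) := by
        simpa using (continuous_neg (G := ℝ)).tendsto 0
      exact this.mono_left nhdsWithin_le_nhds
    · filter_upwards [self_mem_nhdsWithin] with x hx
      simpa using hx
  refine ⟨fun n => -r (k n), hneg.comp (hr.comp hk'), ?_⟩
  have hfin : ∑' n, ν (B \ (fun z => z - r (k n) • w) ⁻¹' B) ≠ ∞ :=
    ne_top_of_le_ne_top ENNReal.one_ne_top
      ((ENNReal.tsum_le_tsum fun n => (hk n).1).trans hδs.le)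
  filter_upwards [ae_eventually_notMem hfin] with z hz hzB
  filter_upwards [hz] with n hn
  by_contra hcon
  refine hn ⟨hzB, fun h => hcon ?_⟩
  simpa [sub_eq_add_neg] using h

end ContinuousAlong

/-- In a product of Souslin spaces every family of open sets has a countable subfamily with the
same union. -/
theorem SouslinSpace.exists_countable_sUnion_eq_prod {X Y : Type*} [TopologicalSpace X]
    [TopologicalSpace Y] [hX : SouslinSpace X] [hY : SouslinSpace Y] (S : Set (Set (X × Y)))
    (hS : ∀ W ∈ S, IsOpen W) : ∃ T ⊆ S, T.Countable ∧ ⋃₀ T = ⋃₀ S := by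
  obtain ⟨P, _, _, f, hf, hfs⟩ := hX.exists_polish
  obtain ⟨Q, _, _, g, hg, hgs⟩ := hY.exists_polish
  obtain ⟨t, htc, ht⟩ := eq_open_union_countable
    (fun W : S => (Prod.map f g) ⁻¹' (W : Set (X × Y)))
    (fun W => (hS W W.2).preimage (hf.prodMap hg))
  refine ⟨(↑) '' t, by rintro _ ⟨W, -, rfl⟩; exact W.2, htc.image _, ?_⟩
  have hpre : Prod.map f g ⁻¹' (⋃₀ ((↑) '' t)) = Prod.map f g ⁻¹' (⋃₀ S) := by
    rw [sUnion_image, preimage_iUnion₂, ht, sUnion_eq_iUnion, preimage_iUnion]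
  exact (hfs.prodMap hgs).preimage_injective hpre

theorem proposition5 {X Y : Type*}
    [AddCommGroup X] [Module ℝ X] [TopologicalSpace X] [IsTopologicalAddGroup X]
    [ContinuousSMul ℝ X] [LocallyConvexSpace ℝ X] [SouslinSpace X]
    [MeasurableSpace X] [BorelSpace X]
    [AddCommGroup Y] [Module ℝ Y] [TopologicalSpace Y] [IsTopologicalAddGroup Y]
    [ContinuousSMul ℝ Y] [LocallyConvexSpace ℝ Y] [SouslinSpace Y]
    [MeasurableSpace Y] [BorelSpace Y]
    (η₁ : Measure X) [IsProbabilityMeasure η₁] (η₂ : Measure Y) [IsProbabilityMeasure η₂]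
    (h : X × Y → ℝ) (hh : Measurable h)
    (hmixed : ∀ᵐ p₀ ∂(η₁.prod η₂), ∃ W : Set (X × Y), IsOpen W ∧ p₀ ∈ W ∧
      ∃ e₁ ∈ continuityVectors η₁, ∃ e₂ ∈ continuityVectors η₂,
        ∀ p ∈ W, ∃ c : ℝ, c ≠ 0 ∧ HasMixedPartialDerivAt h c p e₁ e₂) :
    SatisfiesNondegeneracy h (η₁.prod η₂) := by
  rintro ⟨A, hA, hApos, u, v, huv⟩
  have := SouslinSpace.borelSpace_prod X Y
  set η := η₁.prod η₂
  let S : Set (Set (X × Y)) := {W | IsOpen W ∧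
    ∃ e₁ ∈ continuityVectors η₁, ∃ e₂ ∈ continuityVectors η₂,
      ∀ p ∈ W, ∃ c : ℝ, c ≠ 0 ∧ HasMixedPartialDerivAt h c p e₁ e₂}
  obtain ⟨T, hTS, hTc, hT⟩ := SouslinSpace.exists_countable_sUnion_eq_prod S fun W hW => hW.1
  obtain ⟨W, hWT, hWA⟩ : ∃ W ∈ T, η (A ∩ W) ≠ 0 := by
    by_contra! hcon
    refine hApos.ne' (measure_mono_null (t := (⋃ W ∈ T, A ∩ W) ∪ (⋃₀ S)ᶜ) ?_ ?_)
    · intro z hz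
      by_cases hzS : z ∈ ⋃₀ S
      · rw [← hT] at hzS
        obtain ⟨W, hW, hzW⟩ := hzS
        exact Or.inl (mem_iUnion₂.2 ⟨W, hW, hz, hzW⟩)
      · exact Or.inr hzS
    · refine measure_union_null ((measure_biUnion_null_iff hTc).2 hcon) ?_
      refine measure_mono_null ?_ (ae_iff.1 hmixed)
      rintro z hz ⟨W, hW, hzW, hW'⟩
      exact hz ⟨W, ⟨hW, hW'⟩, hzW⟩
  obtain ⟨hWo, e₁, he₁, e₂, he₂, hW⟩ := hTS hWT
  have hc₁ : ContinuousAlong η ((e₁, 0) : X × Y) :=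
    (continuousAlong_of_mem_continuityVectors he₁).prod_left
      fun _ => (continuous_sub_right _).measurable
  have hc₂ : ContinuousAlong η ((0, e₂) : X × Y) :=
    (continuousAlong_of_mem_continuityVectors he₂).prod_right
      fun _ => (continuous_sub_right _).measurable
  obtain ⟨t, ht, htA⟩ := hc₂.exists_seq_ae_eventually_add_mem hA
  set N := {z | ¬ (z ∈ A → ∀ᶠ n in atTop, z + t n • ((0, e₂) : X × Y) ∈ A)}
  -- Removing a measurable null hull keeps A' measurable, so that recurrence applies to it again.
  have hN : η (toMeasurable η N) = 0 := by rw [measure_toMeasurable]; exact htA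
  -- on almost all of `A ∩ W` the derivative along `e₂` depends on the second coordinate only
  let A' := (A ∩ W) \ toMeasurable η N
  have hA'm : MeasurableSet A' := (hA.inter hWo.measurableSet).diff (measurableSet_toMeasurable _ _)
  have hA'pos : η A' ≠ 0 := by rwa [measure_sdiff_null hN]
  -- The limit may fail to exist for some y; only second coordinates of points of A' matter.
  let g : Y → ℝ := fun y => limUnder atTop fun n => (t n)⁻¹ • (v (y + t n • e₂) - v y)
  have hg : ∀ z ∈ A', lineDeriv ℝ h z (0, e₂) = g z.2 := by
    rintro z ⟨⟨hzA, hzW⟩, hzN⟩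
    have hev : ∀ᶠ n in atTop, z + t n • ((0, e₂) : X × Y) ∈ A := by
      by_contra hcon
      exact hzN (subset_toMeasurable η N fun h => hcon (h hzA))
    obtain ⟨c, -, hd, -⟩ := hW z hzW
    have hd' : LineDifferentiableAt ℝ h z (0, e₂) := by simpa using hd.self_of_nhds
    have hlim := hd'.hasLineDerivAt.tendsto_slope_zero.comp ht
    refine (Tendsto.limUnder_eq (hlim.congr' ?_)).symm
    filter_upwards [hev] with n hn
    have h1 := huv z.1 z.2 hzA
    have h2 := huv (z + t n • ((0, e₂) : X × Y)).1 (z + t n • ((0, e₂) : X × Y)).2 hn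
    simp only [Prod.mk.eta] at h1 h2
    simp only [Function.comp_apply, h1, h2]
    simp
  obtain ⟨s, hs, hsA⟩ := hc₁.exists_seq_ae_eventually_add_mem hA'm
  obtain ⟨z, hzA', hz⟩ : ∃ z ∈ A', ∀ᶠ n in atTop, z + s n • ((e₁, 0) : X × Y) ∈ A' := by
    by_contra hcon
    have hsub : A' ⊆ {z | ¬ (z ∈ A' → ∀ᶠ n in atTop, z + s n • ((e₁, 0) : X × Y) ∈ A')} :=
      fun z hz hz' => hcon ⟨z, hz, hz' hz⟩
    exact hA'pos (measure_mono_null hsub (ae_iff.1 hsA))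
  obtain ⟨c, hc0, -, hd⟩ := hW z hzA'.1.2
  -- Shifting by e₁ fixes the second coordinate, so these difference quotients of ∂h/∂e₂ are
  -- eventually 0.
  refine hc0 (tendsto_nhds_unique (hd.tendsto_slope_zero.comp hs) ?_)
  refine tendsto_const_nhds.congr' ?_
  filter_upwards [hz] with n hn
  simp only [Function.comp_apply, hg _ hn, hg _ hzA']
  simp
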